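/- \textbf{Setting.} There are $n$ buyers and $k$ sellers; a seller set is a subset $\gamma$ of the $k$ sellers, and $D_h(\gamma,\gamma')=|\gamma\,\triangle\,\gamma'|/k$ is the normalized Hamming distance. In one market round, buyer $i$ ordering $\gamma$ obtains a random performance value $P_i(\gamma)\in[0,1]$ at a fixed cost $c(\gamma)\in[0,1]$ (with $P_i(\emptyset)=0$, $c(\emptyset)=0$); her net gain is $G_i(\gamma)=P_i(\gamma)-c(\gamma)$. If buyer $j$ orders $\gamma_j$, buyer $i\neq j$ suffers a random, integrable externality $E_{ij}(\gamma_j)$, where $\sum_{j\ne i}E_{ji}(\gamma)\in[0,1]$ for all $i$ and $\gamma$. All these variables may be arbitrarily correlated within a round. Fix $\alpha\in[0,1]$. Under the order profile $S=(\gamma_1,\dots,\gamma_n)$ buyer $i$ pays the transaction cost $\mathcal T_i(S)=\alpha\bigl(\sum_{j\ne i}E_{ji}(\gamma_i)-\sum_{j\ne i}E_{ij}(\gamma_j)\bigr)$ and has utility $U_i(S)=G_i(\gamma_i)-\sum_{j\ne i}E_{ij}(\gamma_j)-\mathcal T_i(S)$. Her effective utility is $U^e_i(\gamma)=G_i(\gamma)-\alpha\sum_{j\ne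 i}E_{ji}(\gamma)$, with mean $\bar u^e_i(\gamma)$. Let $\gamma_i^d$ be a dominant strategy of buyer $i$ under full information, i.e. an order that maximizes her expected utility $\mathbb E[U_i(S)]$ whatever the others order. \textbf{Closeness} (parameter $\lambda>0$). For every seller set $\gamma$, $$\bar u^e_i(\gamma_i^d)-\bar u^e_i(\gamma)\in\bigl[\lambda\bigl(D_h(\gamma,\gamma_i^d)-\tfrac1k\bigr),\ \lambda D_h(\gamma,\gamma_i^d)\bigr].$$ \textbf{Algorithm.} The market is repeated for $T\ge 2$ rounds; the outcome of each round is a fresh draw from the same joint distribution, independent of everything known when the orders of that round are placed. For buyer $i$ let $n_t(\gamma)$ be the number of rounds before $t$ in which she ordered $\gamma$, $\hat u_t(\gamma)$ the mean of the effective utilities she observed in these rounds ($0$ if there are none), and $c_t(\gamma)=\sqrt{12\log T/(n_t(\gamma)+1)}$. An active set $\gamma'$ covers $\gamma$ at round $t$ if $\lambda D_h(\gamma,\gamma')\le c_t(\gamma')$. Initially one arbitrary seller set is active. In each round $t=1,\dots,T$: if some seller set is not covered by any active set, one arbitrary uncovered seller set becomes active; then buyer $i$ orders an active seller set $\gamma_i^t$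 that maximizes $\hat u_t(\gamma)+2c_t(\gamma)$ over the active $\gamma$. (Arbitrary choices may be randomized and may use all past information.) \textbf{Theorem.} For every $\lambda>0$ there is a constant $C>0$ depending only on $\lambda$ such that for all $n,k$, all such markets, all $\alpha\in[0,1]$, all $T\ge2$, and every buyer $i$ that satisfies closeness with parameter $\lambda$ and runs this algorithm, her expected online effective regret satisfies $$R^i_d(T)=\mathbb E\Bigl[\sum_{t=1}^{T}\bigl(U^e_i(\gamma_i^d)-U^e_i(\gamma_i^t)\bigr)\Bigr]\ \le\ C\,k^2\sqrt{T\log T}+C\,k^3\log^2(T)\,2^{3k/4},$$ where in the $t$-th summand the effective utilities are those realized in round $t$. -/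

import Mathlib

open MeasureTheory ProbabilityTheory

/-- A seller set (an order): a subset of the `k` sellers. -/
abbrev SellerSet (k : ℕ) : Type := Finset (Fin k)

/-- Normalized Hamming distance between two seller sets: the number of sellers in which they
differ, divided by `k`. -/
noncomputable def hammingFrac {k : ℕ} (γ γ' : SellerSet k) : ℝ :=
  ((symmDiff γ γ').card : ℝ) / (k : ℝ)

/-- A fixed-price data market with `n` buyers and `k` sellers. A point of `X` is the random outcome
of one market round, drawn from `law`; the performance gains and externalities are random variables
on `X`, with an arbitrary joint distribution. -/
structure DataMarket (n k : ℕ) (X : Type*) [MeasurableSpace X] where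
  /-- distribution of the outcome of one round -/
  law : Measure X
  isProb : IsProbabilityMeasure law
  /-- `perf i γ` is the value to buyer `i` of the performance increase due to buying from `γ` -/
  perf : Fin n → SellerSet k → X → ℝ
  /-- `cost γ` is the price charged by the sellers in `γ` -/
  cost : SellerSet k → ℝ
  /-- `ext i j γ` is the negative externality that buyer `i` suffers when buyer `j` orders `γ` -/
  ext : Fin n → Fin n → SellerSet k → X → ℝ
  perf_measurable : ∀ i γ, Measurable (perf i γ)
  perf_mem : ∀ i γ x, perf i γ x ∈ Set.Icc (0 : ℝ) 1
  perf_empty : ∀ i x, perf i ∅ x = 0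
  cost_mem : ∀ γ, cost γ ∈ Set.Icc (0 : ℝ) 1
  cost_empty : cost ∅ = 0
  ext_measurable : ∀ i j γ, Measurable (ext i j γ)
  ext_integrable : ∀ i j γ, Integrable (ext i j γ) law
  /-- the total externality created by a buyer lies in `[0, 1]` -/
  ext_sum_mem : ∀ i γ x, ∑ j ∈ Finset.univ.erase i, ext j i γ x ∈ Set.Icc (0 : ℝ) 1

namespace DataMarket

variable {n k : ℕ} {X : Type*} [MeasurableSpace X]

/-- Net gain `G_i(γ)`: performance increase minus cost. -/
def gain (M : DataMarket n k X) (i : Fin n) (γ : SellerSet k) (x : X) : ℝ :=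
  M.perf i γ x - M.cost γ

/-- Transaction cost charged to buyer `i` under the order profile `S`: `α` times the externality
that she causes minus the externality that she suffers. -/
def transactionCost (M : DataMarket n k X) (α : ℝ) (i : Fin n) (S : Fin n → SellerSet k) (x : X) :
    ℝ :=
  α * (∑ j ∈ Finset.univ.erase i, M.ext j i (S i) x - ∑ j ∈ Finset.univ.erase i, M.ext i j (S j) x)

/-- Utility `U_i(S)` of buyer `i` under the order profile `S`. -/
def utility (M : DataMarket n k X) (α : ℝ) (i : Fin n) (S : Fin n → SellerSet k) (x : X) : ℝ :=
  M.gain i (S i) x - ∑ j ∈ Finset.univ.erase i, M.ext i j (S j) x - M.transactionCost α i S x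

/-- Expected utility of buyer `i` under the order profile `S`. -/
noncomputable def meanUtility (M : DataMarket n k X) (α : ℝ) (i : Fin n)
    (S : Fin n → SellerSet k) : ℝ :=
  ∫ x, M.utility α i S x ∂M.law

/-- `γd` is a dominant strategy of buyer `i` under full information: whatever the orders of the
other buyers are, no order gives buyer `i` a larger expected utility than `γd`. -/
def IsDominantStrategy (M : DataMarket n k X) (α : ℝ) (i : Fin n) (γd : SellerSet k) : Prop :=
  ∀ S : Fin n → SellerSet k, M.meanUtility α i S ≤ M.meanUtility α i (Function.update S i γd)

/-- Effective utility `U^e_i(γ)`: the part of the utility of buyer `i` that depends on her order. -/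
def effUtility (M : DataMarket n k X) (α : ℝ) (i : Fin n) (γ : SellerSet k) (x : X) : ℝ :=
  M.gain i γ x - α * ∑ j ∈ Finset.univ.erase i, M.ext j i γ x

/-- Expected effective utility of buyer `i`. -/
noncomputable def meanEffUtility (M : DataMarket n k X) (α : ℝ) (i : Fin n) (γ : SellerSet k) : ℝ :=
  ∫ x, M.effUtility α i γ x ∂M.law

/-- Closeness with parameter `lam`, relative to the seller set `γd`: the gap in expected effective
utility between `γd` and any `γ` is their Hamming distance times `lam`, up to `lam / k`. -/
def Closeness (M : DataMarket n k X) (α lam : ℝ) (i : Fin n) (γd : SellerSet k) : Prop :=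
  ∀ γ : SellerSet k,
    M.meanEffUtility α i γd - M.meanEffUtility α i γ ∈
      Set.Icc (lam * (hammingFrac γ γd - 1 / (k : ℝ))) (lam * hammingFrac γ γd)

variable {Ω : Type*} {mΩ : MeasurableSpace Ω}

/-- The repeated market: `ξ t` is the outcome of round `t` (rounds are numbered from `0`) and `ℱ t`
is the information available when the orders of round `t` are placed, which may include private
randomization of the buyers. Each outcome is a fresh draw from the law of the market. -/
structure IsRepeatedMarket (M : DataMarket n k X) (P : Measure Ω) (ℱ : Filtration ℕ mΩ)
    (ξ : ℕ → Ω → X) : Prop where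
  adapted : ∀ t, Measurable[ℱ (t + 1)] (ξ t)
  map_eq : ∀ t, P.map (ξ t) = M.law
  indep : ∀ t, Indep (MeasurableSpace.comap (ξ t) inferInstance) (ℱ t) P

end DataMarket

/-- The number of rounds before round `t` in which `γ` was ordered, when `order s` is the order of
round `s`. -/
def pullCount {k : ℕ} (order : ℕ → SellerSet k) (t : ℕ) (γ : SellerSet k) : ℕ :=
  ((Finset.range t).filter fun s => order s = γ).card

/-- Confidence radius of `γ` at round `t`, for the horizon `T`. -/
noncomputable def confRadius {k : ℕ} (T : ℕ) (order : ℕ → SellerSet k) (t : ℕ)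
    (γ : SellerSet k) : ℝ :=
  Real.sqrt (12 * Real.log T / ((pullCount order t γ : ℝ) + 1))

/-- `γ` is covered at round `t` by some seller set in `active`. -/
def IsCovered {k : ℕ} (lam : ℝ) (T : ℕ) (order : ℕ → SellerSet k) (t : ℕ)
    (active : Finset (SellerSet k)) (γ : SellerSet k) : Prop :=
  ∃ γ' ∈ active, lam * hammingFrac γ γ' ≤ confRadius T order t γ'

namespace DataMarket

variable {n k : ℕ} {X : Type*} [MeasurableSpace X]

/-- Empirical mean of the effective utilities that buyer `i` observed for `γ` before round `t`,
when `x s` is the outcome of round `s`. It is `0` if `γ` has not been ordered yet. -/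
noncomputable def empMean (M : DataMarket n k X) (α : ℝ) (i : Fin n) (x : ℕ → X)
    (order : ℕ → SellerSet k) (t : ℕ) (γ : SellerSet k) : ℝ :=
  (∑ s ∈ (Finset.range t).filter fun s => order s = γ, M.effUtility α i γ (x s)) /
    (pullCount order t γ : ℝ)

/-- Upper confidence bound of `γ` at round `t`. -/
noncomputable def ucb (M : DataMarket n k X) (α : ℝ) (T : ℕ) (i : Fin n) (x : ℕ → X)
    (order : ℕ → SellerSet k) (t : ℕ) (γ : SellerSet k) : ℝ :=
  M.empMean α i x order t γ + 2 * confRadius T order t γ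

/-- One realization of the zooming algorithm of buyer `i` over `T` rounds. `active t` is the active
set at the beginning of round `t`, `active (t + 1)` the one after the activation step of round `t`,
and `order t` is the order placed in round `t`. The initial seller set, the uncovered seller set
that is activated, and the maximizer of the UCB value may be any admissible ones. -/
structure IsZoomingPath (M : DataMarket n k X) (α lam : ℝ) (T : ℕ) (i : Fin n) (x : ℕ → X)
    (active : ℕ → Finset (SellerSet k)) (order : ℕ → SellerSet k) : Prop where
  init : ∃ γ, active 0 = {γ}
  activate : ∀ t < T, (∃ γ, ¬ IsCovered lam T order t (active t) γ) →
    ∃ γ, ¬ IsCovered lam T order t (active t) γ ∧ active (t + 1) = insert γ (active t)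
  keep : ∀ t < T, (∀ γ, IsCovered lam T order t (active t) γ) → active (t + 1) = active t
  order_mem : ∀ t < T, order t ∈ active (t + 1)
  order_max : ∀ t < T, ∀ γ ∈ active (t + 1),
    M.ucb α T i x order t γ ≤ M.ucb α T i x order t (order t)

variable {Ω : Type*} {mΩ : MeasurableSpace Ω}

/-- Buyer `i` runs the zooming algorithm in the repeated market: every realization is one of the
algorithm, and the order of each round depends only on the information available when it is
placed. -/
structure RunsZooming (M : DataMarket n k X) (α lam : ℝ) (T : ℕ) (i : Fin n) (ℱ : Filtration ℕ mΩ)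
    (ξ : ℕ → Ω → X) (active : ℕ → Ω → Finset (SellerSet k)) (order : ℕ → Ω → SellerSet k) :
    Prop where
  nonanticipating : ∀ t < T, ∀ γ, MeasurableSet[ℱ t] {ω | order t ω = γ}
  path : ∀ ω, M.IsZoomingPath α lam T i (fun t => ξ t ω) (fun t => active t ω) (fun t => order t ω)

/-- Expected online effective regret of buyer `i` over `T` rounds, against `γd`. -/
noncomputable def effRegret (M : DataMarket n k X) (α : ℝ) (i : Fin n) (P : Measure Ω)
    (ξ : ℕ → Ω → X) (order : ℕ → Ω → SellerSet k) (γd : SellerSet k) (T : ℕ) : ℝ :=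
  ∫ ω, ∑ t ∈ Finset.range T,
    (M.effUtility α i γd (ξ t ω) - M.effUtility α i (order t ω) (ξ t ω)) ∂P

end DataMarket

/-!
The deviation of the first `m` observed utilities of a seller set from their mean is a sum over a
predictable set of rounds, hence sub-Gaussian by an exponential supermartingale. So all confidence
intervals hold except with probability `p ≤ 2 ^ (k + 1) / T ^ 2`, and since also `p ≤ 1`, this event
contributes at most `lam * T * p ≤ lam * √(T ^ 2 * p)`, of order `2 ^ (k / 2)`.

When they hold, the set covering `γd` forces every order to have a gap of at most three radii, so
`γ` is ordered at most `108 log T / gap ^ 2` times. A set is activated only while it is uncovered,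
and by closeness gaps are Hamming distances up to one seller; hence the active sets at distance `d`
from `γd` form a constant weight code of minimum distance about `4 * d / 13`, and such a code has at
most `160 * 2 ^ (3 * k / 4)` words. At distance `1` closeness gives no lower bound on the gap, but
there are only `k` such sets, each costing `√(T log T)` up to a constant; at distance `2` or more
the gap is at least `lam / k`, and each active set costs at most `108 k log T / lam`.
-/

section Codes

open Finset
open scoped symmDiff

lemma choose_mul_choose_le_choose_add (a b c d : ℕ) :
    a.choose b * c.choose d ≤ (a + c).choose (b + d) := by
  rw [Nat.add_choose_eq]
  exact single_le_sum (f := fun ij : ℕ × ℕ => a.choose ij.1 * c.choose ij.2)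
    (fun _ _ => Nat.zero_le _) (mem_antidiagonal.2 (rfl : (b, d).1 + (b, d).2 = b + d))

lemma choose_pow_le_choose_mul (a b q : ℕ) : a.choose b ^ q ≤ (a * q).choose (b * q) := by
  induction q with
  | zero => simp
  | succ q ih =>
    calc a.choose b ^ (q + 1) = a.choose b ^ q * a.choose b := pow_succ _ _
      _ ≤ (a * q).choose (b * q) * a.choose b := Nat.mul_le_mul_right _ ih
      _ ≤ (a * (q + 1)).choose (b * (q + 1)) := choose_mul_choose_le_choose_add _ _ _ _

lemma choose_mul_pow_le_one_add_pow {R : Type*} [CommSemiring R] [PartialOrder R]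
    [IsOrderedRing R] {z : R} (hz : 0 ≤ z) (n j : ℕ) : n.choose j * z ^ j ≤ (1 + z) ^ n := by
  rcases lt_or_ge n j with hnj | hjn
  · simpa [Nat.choose_eq_zero_of_lt hnj] using pow_nonneg (add_nonneg zero_le_one hz) n
  · rw [add_comm, add_pow]
    simpa [mul_comm] using single_le_sum (f := fun m => z ^ m * 1 ^ (n - m) * (n.choose m : R))
      (fun m _ => by simpa using mul_nonneg (pow_nonneg hz m) (Nat.cast_nonneg _))
      (mem_range.2 (Nat.lt_succ_of_le hjn))

lemma pow_le_two_rpow_three_fourths_mul (n : ℕ) : (1.68 : ℝ) ^ n ≤ 2 ^ (3 * (n : ℝ) / 4) := by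
  have hbase : (1.68 : ℝ) ≤ 2 ^ (3 / 4 : ℝ) := by
    refine le_of_pow_le_pow_left₀ four_ne_zero (by positivity) ?_
    rw [← Real.rpow_natCast ((2 : ℝ) ^ (3 / 4 : ℝ)), ← Real.rpow_mul zero_le_two]
    norm_num
  calc (1.68 : ℝ) ^ n ≤ ((2 : ℝ) ^ (3 / 4 : ℝ)) ^ n := by gcongr
    _ = 2 ^ (3 * (n : ℝ) / 4) := by
      rw [← Real.rpow_natCast, ← Real.rpow_mul zero_le_two, div_mul_eq_mul_div]

variable {ι : Type*} [DecidableEq ι]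

lemma card_symmDiff_add_two_mul_card_le {x y z : Finset ι} (hx : z ⊆ x) (hy : z ⊆ y) :
    #(x ∆ y) + 2 * #z ≤ #x + #y := by
  have hsub : x ∆ y ⊆ x \ z ∪ y \ z :=
    union_subset_union (sdiff_subset_sdiff subset_rfl hy) (sdiff_subset_sdiff subset_rfl hx)
  have hcard := (card_le_card hsub).trans (card_union_le _ _)
  have hzx := card_sdiff_add_card_eq_card hx
  have hzy := card_sdiff_add_card_eq_card hy
  lia

variable [Fintype ι]

-- The `(d - r)`-subsets of distinct code words are distinct, since two words that share one of them
-- differ in at most `2 * r` places.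
lemma card_mul_choose_le_choose {A : Finset (Finset ι)} {d r : ℕ} (hr : r ≤ d)
    (hA : (A : Set (Finset ι)).Sized d)
    (hsep : (A : Set (Finset ι)).Pairwise fun x y => 2 * r < #(x ∆ y)) :
    #A * d.choose r ≤ (Fintype.card ι).choose (d - r) := by
  have hdisj : (A : Set (Finset ι)).PairwiseDisjoint (powersetCard (d - r)) := by
    refine fun x hx y hy hxy => disjoint_left.2 fun z hzx hzy => ?_
    obtain ⟨hzx, hz⟩ := mem_powersetCard.1 hzx
    have hfar := hsep hx hy hxy
    have hclose := card_symmDiff_add_two_mul_card_le hzx (mem_powersetCard.1 hzy).1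
    rw [hz, hA hx, hA hy] at hclose
    lia
  calc #A * d.choose r = ∑ x ∈ A, #(powersetCard (d - r) x) := by
        rw [sum_congr rfl fun x hx => by rw [card_powersetCard, hA hx, Nat.choose_symm hr],
          sum_const, smul_eq_mul]
    _ = #(A.biUnion (powersetCard (d - r))) := (card_biUnion hdisj).symm
    _ ≤ #(powersetCard (d - r) (univ : Finset ι)) :=
        card_le_card (biUnion_subset.2 fun x _ => powersetCard_mono (subset_univ x))
    _ = (Fintype.card ι).choose (d - r) := by rw [card_powersetCard, card_univ]

lemma card_le_of_sized_of_separated {A : Finset (Finset ι)} {d : ℕ} (hd : 1 ≤ d)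
    (hA : (A : Set (Finset ι)).Sized d)
    (hsep : (A : Set (Finset ι)).Pairwise fun x y => 4 * d < 13 * #(x ∆ y) + 4) :
    (#A : ℝ) ≤ 160 * 2 ^ (3 * (Fintype.card ι : ℝ) / 4) := by
  -- With `d ≈ 13 q` and `r = 2 q` the packing bound is `#A * 78 ^ q ≤ k.choose (11 q + s)`, where
  -- `78 = (13).choose 2`. The weight `z = 0.68` satisfies both `1 ≤ 78 * z ^ 11` and
  -- `1 + z ≤ 2 ^ (3 / 4)`, and `160` absorbs `z ^ s`.
  obtain ⟨q, s, hs₁, hs₁₃, rfl⟩ : ∃ q s, 1 ≤ s ∧ s ≤ 13 ∧ d = 13 * q + s :=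
    ⟨(d - 1) / 13, (d - 1) % 13 + 1, by lia, by lia, by lia⟩
  set k := Fintype.card ι
  have hchoose : 78 ^ q ≤ (13 * q + s).choose (2 * q) :=
    (choose_pow_le_choose_mul 13 2 q).trans (Nat.choose_le_choose _ (Nat.le_add_right _ _))
  have hpack : #A * 78 ^ q ≤ k.choose (11 * q + s) := by
    have hle := card_mul_choose_le_choose (r := 2 * q) (by lia) hA
      (hsep.mono' fun x y hxy => by lia)
    rw [show 13 * q + s - 2 * q = 11 * q + s by lia] at hle
    exact (Nat.mul_le_mul_left _ hchoose).trans hle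
  have hz₁₁ : (1 : ℝ) ≤ 78 ^ q * 0.68 ^ (11 * q) := by
    rw [pow_mul, ← mul_pow]
    exact one_le_pow₀ (by norm_num)
  have hzs : (1 / 160 : ℝ) ≤ 0.68 ^ s :=
    le_trans (by norm_num) (pow_le_pow_of_le_one (by norm_num) (by norm_num) hs₁₃)
  have hmain : #A * (1 / 160 : ℝ) ≤ 2 ^ (3 * (k : ℝ) / 4) := by
    calc #A * (1 / 160 : ℝ) ≤ #A * 0.68 ^ s * (78 ^ q * 0.68 ^ (11 * q)) :=
          (by gcongr : _ ≤ #A * (0.68 : ℝ) ^ s).trans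
            (le_mul_of_one_le_right (by positivity) hz₁₁)
      _ = (#A * 78 ^ q : ℕ) * 0.68 ^ (11 * q + s) := by push_cast; ring
      _ ≤ k.choose (11 * q + s) * 0.68 ^ (11 * q + s) := by gcongr
      _ ≤ (1 + 0.68) ^ k := choose_mul_pow_le_one_add_pow (by norm_num) _ _
      _ = 1.68 ^ k := by norm_num
      _ ≤ 2 ^ (3 * (k : ℝ) / 4) := pow_le_two_rpow_three_fourths_mul k
  linarith

lemma card_le_of_sphere_of_separated {A : Finset (Finset ι)} {c : Finset ι} {d : ℕ} (hd : 1 ≤ d)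
    (hA : ∀ x ∈ A, #(x ∆ c) = d)
    (hsep : (A : Set (Finset ι)).Pairwise fun x y => 4 * d < 13 * #(x ∆ y) + 4) :
    (#A : ℝ) ≤ 160 * 2 ^ (3 * (Fintype.card ι : ℝ) / 4) := by
  have hinj : Function.Injective (· ∆ c) := symmDiff_left_injective c
  rw [← card_image_of_injective A hinj]
  refine card_le_of_sized_of_separated hd ?_ ?_
  · simpa [Set.Sized] using hA
  · rw [coe_image, hinj.injOn.pairwise_image]
    refine hsep.mono' fun x y hxy => ?_
    rwa [Function.onFun, symmDiff_symmDiff_symmDiff_comm, symmDiff_self, symmDiff_bot]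

lemma card_le_of_separated_on_spheres {A : Finset (Finset ι)} {c : Finset ι} (hc : c ∉ A)
    (hsep : ∀ x ∈ A, ∀ y ∈ A, x ≠ y → #(x ∆ c) = #(y ∆ c) → 4 * #(x ∆ c) < 13 * #(x ∆ y) + 4) :
    (#A : ℝ) ≤ Fintype.card ι * (160 * 2 ^ (3 * (Fintype.card ι : ℝ) / 4)) := by
  have hmaps : Set.MapsTo (fun x => #(x ∆ c)) A (Icc 1 (Fintype.card ι)) := by
    intro x hx
    have hxc : x ≠ c := fun h => hc (h ▸ hx)
    exact mem_coe.2 (mem_Icc.2 ⟨card_pos.2 (symmDiff_nonempty.2 hxc), card_le_univ _⟩)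
  rw [card_eq_sum_card_fiberwise hmaps, Nat.cast_sum]
  calc ∑ d ∈ Icc 1 (Fintype.card ι), (#{x ∈ A | #(x ∆ c) = d} : ℝ)
      ≤ #(Icc 1 (Fintype.card ι)) • (160 * 2 ^ (3 * (Fintype.card ι : ℝ) / 4) : ℝ) := by
        refine sum_le_card_nsmul _ _ _ fun d hd => ?_
        refine card_le_of_sphere_of_separated (c := c) (mem_Icc.1 hd).1 (by simp) ?_
        intro x hx y hy hxy
        simp only [coe_filter, Set.mem_ofPred_eq] at hx hy
        exact hx.2 ▸ hsep x hx.1 y hy.1 hxy (hx.2.trans hy.2.symm)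
    _ = Fintype.card ι * (160 * 2 ^ (3 * (Fintype.card ι : ℝ) / 4)) := by simp

lemma card_filter_card_symmDiff_eq (c : Finset ι) (d : ℕ) :
    #{x : Finset ι | #(x ∆ c) = d} = (Fintype.card ι).choose d := by
  rw [← card_univ, ← card_powersetCard]
  refine card_bij' (fun x _ => x ∆ c) (fun x _ => x ∆ c) ?_ ?_ ?_ ?_ <;>
    simp +contextual [mem_powersetCard]

end Codes

section Probability

variable {Ω : Type*} {mΩ : MeasurableSpace Ω} {P : Measure Ω}

lemma integral_le_add_mul_measureReal [IsProbabilityMeasure P] {f : Ω → ℝ} {S : Set Ω} {a b : ℝ}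
    (hf : Integrable f P) (hfa : ∀ ω ∉ S, f ω ≤ a) (hfb : ∀ ω, f ω ≤ a + b) :
    ∫ ω, f ω ∂P ≤ a + b * P.real S := by
  -- `S` need not be measurable; its measurable hull has the same measure
  set S' := toMeasurable P S
  have hS' : MeasurableSet S' := measurableSet_toMeasurable P S
  have hint : Integrable (S'.indicator fun _ => b) P := (integrable_const b).indicator hS'
  calc ∫ ω, f ω ∂P ≤ ∫ ω, a + S'.indicator (fun _ => b) ω ∂P := by
        refine integral_mono hf ((integrable_const a).add hint) fun ω => ?_
        by_cases hω : ω ∈ S'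
        · simpa [hω] using hfb ω
        · simpa [hω] using hfa ω fun h => hω (subset_toMeasurable P S h)
    _ = a + b * P.real S := by
        rw [integral_add (integrable_const a) hint, integral_indicator_const b hS']
        simp [S', Measure.real, mul_comm]

lemma measureReal_le_abs_le_of_hasSubgaussianMGF [IsFiniteMeasure P] {X : Ω → ℝ} {c : NNReal}
    (hX : HasSubgaussianMGF X c P) {ε : ℝ} (hε : 0 ≤ ε) :
    P.real {ω | ε ≤ |X ω|} ≤ 2 * Real.exp (-ε ^ 2 / (2 * c)) := by
  have hunion : {ω | ε ≤ |X ω|} = {ω | ε ≤ X ω} ∪ {ω | ε ≤ (-X) ω} := by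
    ext ω
    simp [le_abs]
  calc P.real {ω | ε ≤ |X ω|} ≤ P.real {ω | ε ≤ X ω} + P.real {ω | ε ≤ (-X) ω} :=
        hunion ▸ measureReal_union_le _ _
    _ ≤ Real.exp (-ε ^ 2 / (2 * c)) + Real.exp (-ε ^ 2 / (2 * c)) :=
        add_le_add (hX.measure_ge_le hε) (hX.neg.measure_ge_le hε)
    _ = 2 * Real.exp (-ε ^ 2 / (2 * c)) := (two_mul _).symm

lemma integrable_and_integral_exp_mul_sub_le_one {X : Ω → ℝ} {c : NNReal}
    (hX : HasSubgaussianMGF X c P) (s : ℝ) :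
    Integrable (fun ω => Real.exp (s * X ω - c * s ^ 2 / 2)) P ∧
      ∫ ω, Real.exp (s * X ω - c * s ^ 2 / 2) ∂P ≤ 1 := by
  simp only [Real.exp_sub, integral_div]
  exact ⟨(hX.integrable_exp_mul s).div_const _,
    div_le_one_of_le₀ (hX.mgf_le s) (Real.exp_pos _).le⟩

lemma exp_mul_sum_indicator_le {Ω : Type*} {A : ℕ → Set Ω} {T : ℕ} (Y : ℕ → Ω → ℝ) {b m : ℝ}
    (hb : 0 ≤ b) (s : ℝ) {ω : Ω} (hm : ∑ r ∈ Finset.range T, (A r).indicator 1 ω ≤ m) :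
    Real.exp (s * ∑ r ∈ Finset.range T, (A r).indicator (Y r) ω) ≤
      Real.exp (m * b) *
        Real.exp (∑ r ∈ Finset.range T, (A r).indicator (fun ω => s * Y r ω - b) ω) := by
  have hsum : ∑ r ∈ Finset.range T, (A r).indicator (fun ω => s * Y r ω - b) ω =
      s * ∑ r ∈ Finset.range T, (A r).indicator (Y r) ω -
        (∑ r ∈ Finset.range T, (A r).indicator 1 ω) * b := by
    rw [Finset.mul_sum, Finset.sum_mul, ← Finset.sum_sub_distrib]
    refine Finset.sum_congr rfl fun r _ => ?_
    by_cases hr : ω ∈ A r <;> simp [hr]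
  rw [← Real.exp_add, Real.exp_le_exp, hsum]
  linarith [mul_le_mul_of_nonneg_right hm hb]

lemma integral_comp_of_indepFun {β X : Type*} [MeasurableSpace β] [MeasurableSpace X]
    [IsFiniteMeasure P] {Y : Ω → β} {ξ : Ω → X} (hY : AEMeasurable Y P) (hξ : AEMeasurable ξ P)
    (hindep : IndepFun Y ξ P) {f : β × X → ℝ}
    (hf : Integrable f ((P.map Y).prod (P.map ξ))) :
    ∫ ω, f (Y ω, ξ ω) ∂P = ∫ ω, ∫ x, f (Y ω, x) ∂(P.map ξ) ∂P := by
  have hmap := (indepFun_iff_map_prod_eq_prod_map_map hY hξ).1 hindep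
  calc ∫ ω, f (Y ω, ξ ω) ∂P = ∫ p, f p ∂(P.map fun ω => (Y ω, ξ ω)) :=
        (integral_map (hY.prodMk hξ) (hmap ▸ hf.aestronglyMeasurable)).symm
    _ = ∫ y, ∫ x, f (y, x) ∂(P.map ξ) ∂(P.map Y) := by rw [hmap, integral_prod f hf]
    _ = ∫ ω, ∫ x, f (Y ω, x) ∂(P.map ξ) ∂P :=
        integral_map hY hf.aestronglyMeasurable.integral_prod_right'

variable [IsProbabilityMeasure P] {ℱ : Filtration ℕ mΩ} {A : ℕ → Set Ω} {T : ℕ}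

-- The exponentials form a supermartingale: conditionally on `ℱ t`, round `t` multiplies them by a
-- factor of mean at most one, or by one outside `A t`.
lemma integrable_and_integral_exp_sum_indicator_le_one {W : ℕ → Ω → ℝ}
    (hA : ∀ t < T, MeasurableSet[ℱ t] (A t)) (hW : ∀ t, Measurable[ℱ (t + 1)] (W t))
    (hindep : ∀ t, Indep (MeasurableSpace.comap (W t) inferInstance) (ℱ t) P)
    (hint : ∀ t, Integrable (fun ω => Real.exp (W t ω)) P)
    (hle : ∀ t, ∫ ω, Real.exp (W t ω) ∂P ≤ 1) :
    Integrable (fun ω => Real.exp (∑ r ∈ Finset.range T, (A r).indicator (W r) ω)) P ∧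
      ∫ ω, Real.exp (∑ r ∈ Finset.range T, (A r).indicator (W r) ω) ∂P ≤ 1 := by
  induction T with
  | zero => simp
  | succ T ih =>
    set Z : Ω → ℝ := fun ω => Real.exp (∑ r ∈ Finset.range T, (A r).indicator (W r) ω)
    set V : Ω → ℝ := fun ω => Real.exp (W T ω)
    obtain ⟨hZint, hZle⟩ : Integrable Z P ∧ ∫ ω, Z ω ∂P ≤ 1 := ih fun t ht => hA t (by lia)
    have hAT := hA T T.lt_succ_self
    have hAT' : MeasurableSet (A T) := ℱ.le T _ hAT
    have hZ : Measurable[ℱ T] Z := by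
      refine (Finset.measurable_fun_sum _ fun r hr => ?_).exp
      have hr : r < T := Finset.mem_range.1 hr
      exact ((hW r).mono (ℱ.mono hr) le_rfl).indicator (ℱ.mono hr.le _ (hA r (by lia)))
    have hindepZV : IndepFun ((A T).indicator Z) V P := by
      rw [IndepFun_iff_Indep]
      exact indep_of_indep_of_le_left (indep_of_indep_of_le_right (hindep T).symm
        (Real.measurable_exp.comp (comap_measurable (W T))).comap_le) (hZ.indicator hAT).comap_le
    have hZAint : Integrable ((A T).indicator Z) P := hZint.indicator hAT'
    have hZVint : Integrable ((A T).indicator Z * V) P := hindepZV.integrable_mul hZAint (hint T)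
    have hsplit : (fun ω => Real.exp (∑ r ∈ Finset.range (T + 1), (A r).indicator (W r) ω)) =
        (A T)ᶜ.indicator Z + (A T).indicator Z * V := by
      funext ω
      by_cases hω : ω ∈ A T <;> simp [hω, Finset.sum_range_succ, Real.exp_add, Z, V]
    rw [hsplit]
    refine ⟨(hZint.indicator hAT'.compl).add hZVint, ?_⟩
    calc ∫ ω, ((A T)ᶜ.indicator Z + (A T).indicator Z * V) ω ∂P
        = ∫ ω, (A T)ᶜ.indicator Z ω ∂P + (∫ ω, (A T).indicator Z ω ∂P) * ∫ ω, V ω ∂P := by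
          rw [integral_add' (hZint.indicator hAT'.compl) hZVint,
            hindepZV.integral_mul_eq_mul_integral hZAint.aestronglyMeasurable
              (hint T).aestronglyMeasurable]
      _ ≤ ∫ ω, (A T)ᶜ.indicator Z ω ∂P + ∫ ω, (A T).indicator Z ω ∂P := by
          gcongr
          refine mul_le_of_le_one_right (integral_nonneg fun ω => ?_) (hle T)
          exact Set.indicator_nonneg (fun _ _ => (Real.exp_pos _).le) ω
      _ = ∫ ω, Z ω ∂P := by
          rw [← integral_add' (hZint.indicator hAT'.compl) hZAint, Set.indicator_compl_add_self]
      _ ≤ 1 := hZle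

lemma hasSubgaussianMGF_sum_indicator {Y : ℕ → Ω → ℝ} {c m : NNReal}
    (hA : ∀ t < T, MeasurableSet[ℱ t] (A t)) (hY : ∀ t, Measurable[ℱ (t + 1)] (Y t))
    (hindep : ∀ t, Indep (MeasurableSpace.comap (Y t) inferInstance) (ℱ t) P)
    (hsub : ∀ t, HasSubgaussianMGF (Y t) c P)
    (hm : ∀ ω, ∑ r ∈ Finset.range T, (A r).indicator 1 ω ≤ (m : ℝ)) :
    HasSubgaussianMGF (fun ω => ∑ r ∈ Finset.range T, (A r).indicator (Y r) ω) (m * c) P := by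
  have hmeas : Measurable fun ω => ∑ r ∈ Finset.range T, (A r).indicator (Y r) ω :=
    Finset.measurable_fun_sum _ fun r hr =>
      ((hY r).mono (ℱ.le _) le_rfl).indicator (ℱ.le r _ (hA r (Finset.mem_range.1 hr)))
  have hbound : ∀ s : ℝ,
      Integrable (fun ω => Real.exp (s * ∑ r ∈ Finset.range T, (A r).indicator (Y r) ω)) P ∧
      ∫ ω, Real.exp (s * ∑ r ∈ Finset.range T, (A r).indicator (Y r) ω) ∂P ≤
        Real.exp (m * (c * s ^ 2 / 2)) := by
    intro s
    obtain ⟨hint, hle⟩ := integrable_and_integral_exp_sum_indicator_le_one hA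
      (fun t => ((hY t).const_mul s).sub_const (c * s ^ 2 / 2))
      (fun t => indep_of_indep_of_le_left (hindep t)
        (((comap_measurable (Y t)).const_mul s).sub_const _).comap_le)
      (fun t => (integrable_and_integral_exp_mul_sub_le_one (hsub t) s).1)
      (fun t => (integrable_and_integral_exp_mul_sub_le_one (hsub t) s).2)
    have hdom := fun ω =>
      exp_mul_sum_indicator_le Y (by positivity : 0 ≤ c * s ^ 2 / 2) s (hm ω)
    have hint' := (hint.const_mul (Real.exp (m * (c * s ^ 2 / 2)))).mono'
      (hmeas.const_mul s).exp.aestronglyMeasurable (.of_forall fun ω => by simpa using hdom ω)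
    refine ⟨hint', (integral_mono hint' (hint.const_mul _) hdom).trans ?_⟩
    rw [integral_const_mul]
    exact mul_le_of_le_one_right (Real.exp_pos _).le hle
  refine ⟨fun s => (hbound s).1, fun s => (hbound s).2.trans_eq ?_⟩
  congr 1
  push_cast
  ring

end Probability

section Paths

open Finset
open scoped symmDiff

variable {k : ℕ}

lemma half_le_log_natCast {T : ℕ} (hT : 2 ≤ T) : 1 / 2 ≤ Real.log T := by
  have hlog : Real.log 2 ≤ Real.log T := Real.log_le_log two_pos (by exact_mod_cast hT)
  linarith [Real.log_two_gt_d9]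

lemma hammingFrac_self (γ : SellerSet k) : hammingFrac γ γ = 0 := by
  simp [hammingFrac]

lemma hammingFrac_comm (γ γ' : SellerSet k) : hammingFrac γ γ' = hammingFrac γ' γ := by
  rw [hammingFrac, hammingFrac, symmDiff_comm]

lemma hammingFrac_le_one (γ γ' : SellerSet k) : hammingFrac γ γ' ≤ 1 := by
  refine div_le_one_of_le₀ ?_ (Nat.cast_nonneg k)
  exact_mod_cast (card_le_univ (γ ∆ γ')).trans_eq (Fintype.card_fin k)

variable (order : ℕ → SellerSet k) (T t : ℕ) (γ : SellerSet k)

lemma pullCount_zero : pullCount order 0 γ = 0 := by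
  simp [pullCount]

lemma pullCount_succ :
    pullCount order (t + 1) γ = pullCount order t γ + if order t = γ then 1 else 0 := by
  rw [pullCount, range_add_one, filter_insert]
  split_ifs
  · rw [card_insert_of_notMem (by simp), pullCount]
  · rw [pullCount, add_zero]

lemma pullCount_mono : Monotone fun t => pullCount order t γ :=
  monotone_nat_of_le_succ fun t => by simp [pullCount_succ]

lemma pullCount_le : pullCount order t γ ≤ t :=
  (card_filter_le _ _).trans_eq (card_range t)

lemma card_filter_pullCount_lt (m : ℕ) :
    #{r ∈ range T | order r = γ ∧ pullCount order r γ < m} = min (pullCount order T γ) m := by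
  induction T with
  | zero => simp [pullCount_zero]
  | succ T ih =>
    rw [range_add_one, filter_insert, pullCount_succ]
    by_cases ho : order T = γ
    · by_cases hm : pullCount order T γ < m
      · rw [if_pos ⟨ho, hm⟩, card_insert_of_notMem (by simp), ih, if_pos ho]
        lia
      · rw [if_neg fun h => hm h.2, ih, if_pos ho]
        lia
    · rw [if_neg fun h => ho h.1, ih, if_neg ho, add_zero]

variable {T t} in
lemma filter_pullCount_lt_pullCount (ht : t ≤ T) :
    {r ∈ range T | order r = γ ∧ pullCount order r γ < pullCount order t γ} =
      {r ∈ range t | order r = γ} := by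
  ext r
  simp only [mem_filter, mem_range]
  refine ⟨fun ⟨_, ho, hc⟩ => ⟨(pullCount_mono order γ).reflect_lt hc, ho⟩, fun ⟨hr, ho⟩ => ?_⟩
  have hsucc : pullCount order (r + 1) γ ≤ pullCount order t γ :=
    pullCount_mono order γ (Nat.succ_le_of_lt hr)
  rw [pullCount_succ, if_pos ho] at hsucc
  exact ⟨hr.trans_le ht, ho, by lia⟩

lemma sum_comp_order_eq_sum_pullCount_mul (f : SellerSet k → ℝ) :
    ∑ t ∈ range T, f (order t) = ∑ γ, pullCount order T γ * f γ := by
  rw [← sum_fiberwise (range T) order]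
  refine sum_congr rfl fun γ _ => ?_
  rw [sum_congr rfl fun t ht => by rw [(mem_filter.1 ht).2], sum_const, nsmul_eq_mul, pullCount]

lemma confRadius_nonneg : 0 ≤ confRadius T order t γ :=
  Real.sqrt_nonneg _

lemma confRadius_sq : confRadius T order t γ ^ 2 = 12 * Real.log T / (pullCount order t γ + 1) :=
  Real.sq_sqrt (div_nonneg (mul_nonneg (by norm_num) (Real.log_natCast_nonneg T)) (by positivity))

variable {order T t γ}

lemma two_le_confRadius (hT : 2 ≤ T) (hγ : pullCount order t γ = 0) :
    2 ≤ confRadius T order t γ := by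
  refine Real.le_sqrt_of_sq_le ?_
  rw [hγ, Nat.cast_zero, zero_add, div_one]
  linarith [half_le_log_natCast hT]

lemma isCovered_of_mem {lam : ℝ} {A : Finset (SellerSet k)} (hγ : γ ∈ A) :
    IsCovered lam T order t A γ :=
  ⟨γ, hγ, by rw [hammingFrac_self, mul_zero]; exact confRadius_nonneg _ _ _ _⟩

lemma lt_hammingFrac_of_not_isCovered {lam : ℝ} {A : Finset (SellerSet k)} {γ' : SellerSet k}
    (hγ : ¬ IsCovered lam T order t A γ) (hγ' : γ' ∈ A) :
    confRadius T order t γ' < lam * hammingFrac γ γ' :=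
  lt_of_not_ge fun hle => hγ ⟨γ', hγ', hle⟩

end Paths

namespace DataMarket

open Finset
open scoped symmDiff

variable {n k : ℕ} {X : Type*} [MeasurableSpace X]

/-- Expected effective utility that buyer `i` loses by ordering `γ` instead of `γd`. -/
noncomputable def gap (M : DataMarket n k X) (α : ℝ) (i : Fin n) (γd γ : SellerSet k) : ℝ :=
  M.meanEffUtility α i γd - M.meanEffUtility α i γ

/-- The realization `x`, `order` is *clean* if at every round before `T` the confidence interval of
every seller set, of radius `confRadius`, contains the expected effective utility. -/
def IsClean (M : DataMarket n k X) (α : ℝ) (T : ℕ) (i : Fin n) (x : ℕ → X)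
    (order : ℕ → SellerSet k) : Prop :=
  ∀ t < T, ∀ γ,
    |M.empMean α i x order t γ - M.meanEffUtility α i γ| ≤ confRadius T order t γ

variable {M : DataMarket n k X} {α lam : ℝ} {T : ℕ} {i : Fin n} {γd : SellerSet k}

namespace Closeness

lemma gap_le (h : M.Closeness α lam i γd) (γ : SellerSet k) :
    M.gap α i γd γ ≤ lam * hammingFrac γ γd :=
  (h γ).2

lemma le_gap (h : M.Closeness α lam i γd) (γ : SellerSet k) :
    lam / k * (#(γ ∆ γd) - 1) ≤ M.gap α i γd γ := by
  refine le_of_eq_of_le ?_ (h γ).1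
  rw [hammingFrac, ← sub_div, div_mul_eq_mul_div, mul_div_assoc]

lemma gap_le_lam (h : M.Closeness α lam i γd) (hlam : 0 ≤ lam) (γ : SellerSet k) :
    M.gap α i γd γ ≤ lam :=
  (h.gap_le γ).trans (mul_le_of_le_one_right hlam (hammingFrac_le_one _ _))

lemma gap_nonneg (h : M.Closeness α lam i γd) (hlam : 0 ≤ lam) (γ : SellerSet k) :
    0 ≤ M.gap α i γd γ := by
  rcases eq_or_ne γ γd with rfl | hne
  · rw [gap, sub_self]
  · have hcard : 1 ≤ #(γ ∆ γd) := card_pos.2 (symmDiff_nonempty.2 hne)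
    have hcard' : (0 : ℝ) ≤ #(γ ∆ γd) - 1 := sub_nonneg.2 (by exact_mod_cast hcard)
    exact le_trans (by positivity) (h.le_gap γ)

lemma div_le_gap (h : M.Closeness α lam i γd) (hlam : 0 ≤ lam) {γ : SellerSet k}
    (hγ : 2 ≤ #(γ ∆ γd)) : lam / k ≤ M.gap α i γd γ := by
  have hγ' : (2 : ℝ) ≤ #(γ ∆ γd) := by exact_mod_cast hγ
  exact (le_mul_of_one_le_right (by positivity) (by linarith)).trans (h.le_gap γ)

lemma four_mul_card_lt (h : M.Closeness α lam i γd) (hlam : 0 ≤ lam) {γ γ₁ γ₂ : SellerSet k}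
    (hγ : 1 ≤ #(γ ∆ γd)) (hgap : M.gap α i γd γ ^ 2 < 10 * (lam * hammingFrac γ₁ γ₂) ^ 2) :
    4 * #(γ ∆ γd) < 13 * #(γ₁ ∆ γ₂) + 4 := by
  have hd : (0 : ℝ) ≤ #(γ ∆ γd) - 1 := sub_nonneg.2 (by exact_mod_cast hγ)
  have hsq : (lam / k) ^ 2 * (#(γ ∆ γd) - 1 : ℝ) ^ 2 < (lam / k) ^ 2 * (10 * #(γ₁ ∆ γ₂) ^ 2) :=
    calc (lam / k) ^ 2 * (#(γ ∆ γd) - 1 : ℝ) ^ 2 = (lam / k * (#(γ ∆ γd) - 1)) ^ 2 := by ring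
      _ ≤ M.gap α i γd γ ^ 2 := pow_le_pow_left₀ (by positivity) (h.le_gap γ) 2
      _ < 10 * (lam * hammingFrac γ₁ γ₂) ^ 2 := hgap
      _ = (lam / k) ^ 2 * (10 * #(γ₁ ∆ γ₂) ^ 2) := by rw [hammingFrac]; ring
  have hsq' : (#(γ ∆ γd) - 1 : ℝ) ^ 2 < 10 * #(γ₁ ∆ γ₂) ^ 2 :=
    lt_of_mul_lt_mul_left hsq (sq_nonneg _)
  have hlt : 4 * (#(γ ∆ γd) - 1 : ℝ) < 13 * #(γ₁ ∆ γ₂) := by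
    -- `10 < (13 / 4) ^ 2`
    refine lt_of_pow_lt_pow_left₀ 2 (by positivity) ?_
    linarith [sq_nonneg (#(γ₁ ∆ γ₂) : ℝ)]
  have hlt' : (4 * #(γ ∆ γd) : ℝ) < 13 * #(γ₁ ∆ γ₂) + 4 := by linarith
  exact_mod_cast hlt'

end Closeness

namespace IsZoomingPath

variable {x : ℕ → X} {active : ℕ → Finset (SellerSet k)} {order : ℕ → SellerSet k}

lemma active_subset_succ (h : M.IsZoomingPath α lam T i x active order) {t : ℕ} (ht : t < T) :
    active t ⊆ active (t + 1) := by
  by_cases hcov : ∀ γ, IsCovered lam T order t (active t) γ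
  · rw [h.keep t ht hcov]
  · obtain ⟨γ, -, hγ⟩ := h.activate t ht (not_forall.1 hcov)
    exact hγ ▸ subset_insert _ _

lemma mem_active_of_pullCount_ne_zero (h : M.IsZoomingPath α lam T i x active order) {t : ℕ}
    (ht : t ≤ T) {γ : SellerSet k} (hγ : pullCount order t γ ≠ 0) : γ ∈ active t := by
  induction t with
  | zero => exact absurd (pullCount_zero order γ) hγ
  | succ t ih =>
    rw [pullCount_succ] at hγ
    split_ifs at hγ with ho
    · exact ho ▸ h.order_mem t ht
    · exact h.active_subset_succ ht (ih (by lia) (by lia))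

-- An uncovered set has not been ordered, so once activated its radius exceeds `lam`, that is, the
-- diameter.
lemma isCovered_succ (h : M.IsZoomingPath α lam T i x active order) (hlam : 0 ≤ lam)
    (hT : lam ^ 2 ≤ 12 * Real.log T) {t : ℕ} (ht : t < T) (γ : SellerSet k) :
    IsCovered lam T order t (active (t + 1)) γ := by
  by_cases hcov : ∀ γ, IsCovered lam T order t (active t) γ
  · rw [h.keep t ht hcov]
    exact hcov γ
  · obtain ⟨γ', huncov, hinsert⟩ := h.activate t ht (not_forall.1 hcov)
    have hcount : pullCount order t γ' = 0 := by
      by_contra hne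
      exact huncov (isCovered_of_mem (h.mem_active_of_pullCount_ne_zero ht.le hne))
    refine ⟨γ', hinsert ▸ mem_insert_self _ _, ?_⟩
    calc lam * hammingFrac γ γ' ≤ lam := mul_le_of_le_one_right hlam (hammingFrac_le_one _ _)
      _ ≤ confRadius T order t γ' := Real.le_sqrt_of_sq_le (by simpa [hcount] using hT)

-- The seller set that covers `γd` has a UCB value of at least the mean at `γd`, and the order has
-- at least this value.
lemma gap_order_le (h : M.IsZoomingPath α lam T i x active order) (hlam : 0 ≤ lam)
    (hT : lam ^ 2 ≤ 12 * Real.log T) (hcl : M.Closeness α lam i γd)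
    (hclean : M.IsClean α T i x order) {t : ℕ} (ht : t < T) :
    M.gap α i γd (order t) ≤ 3 * confRadius T order t (order t) := by
  obtain ⟨γ, hγ, hcov⟩ := h.isCovered_succ hlam hT ht γd
  have hgap := (hcl.gap_le γ).trans (hammingFrac_comm γ γd ▸ hcov)
  have hmax := h.order_max t ht γ hγ
  have hγmean := abs_le.1 (hclean t ht γ)
  have hordermean := abs_le.1 (hclean t ht (order t))
  unfold ucb at hmax
  unfold gap at hgap ⊢
  linarith

lemma pullCount_mul_gap_sq_le (h : M.IsZoomingPath α lam T i x active order) (hlam : 0 ≤ lam)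
    (hT : lam ^ 2 ≤ 12 * Real.log T) (hcl : M.Closeness α lam i γd)
    (hclean : M.IsClean α T i x order) {t : ℕ} (ht : t ≤ T) (γ : SellerSet k) :
    pullCount order t γ * M.gap α i γd γ ^ 2 ≤ 108 * Real.log T := by
  induction t with
  | zero =>
    rw [pullCount_zero, Nat.cast_zero, zero_mul]
    exact mul_nonneg (by norm_num) (Real.log_natCast_nonneg T)
  | succ t ih =>
    rw [pullCount_succ]
    split_ifs with ho
    · have hsq := pow_le_pow_left₀ (hcl.gap_nonneg hlam γ)
        (ho ▸ h.gap_order_le hlam hT hcl hclean ht) 2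
      rw [mul_pow, confRadius_sq, ← mul_div_assoc, le_div_iff₀ (by positivity)] at hsq
      push_cast
      linarith
    · exact ih (by lia)

lemma gap_sq_le (h : M.IsZoomingPath α lam T i x active order) (hlam : 0 ≤ lam)
    (hT : lam ^ 2 ≤ 12 * Real.log T) (hcl : M.Closeness α lam i γd)
    (hclean : M.IsClean α T i x order) {t : ℕ} (ht : t ≤ T) (γ : SellerSet k) :
    M.gap α i γd γ ^ 2 ≤ 10 * confRadius T order t γ ^ 2 := by
  have hlam_sq := pow_le_pow_left₀ (hcl.gap_nonneg hlam γ) (hcl.gap_le_lam hlam γ) 2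
  rw [confRadius_sq, ← mul_div_assoc, le_div_iff₀ (by positivity)]
  linarith [h.pullCount_mul_gap_sq_le hlam hT hcl hclean ht γ]

lemma gap_sq_lt_of_mem_active (h : M.IsZoomingPath α lam T i x active order) (hlam : 0 ≤ lam)
    (hT : lam ^ 2 ≤ 12 * Real.log T) (hcl : M.Closeness α lam i γd)
    (hclean : M.IsClean α T i x order) {t : ℕ} (ht : t ≤ T) {γ γ' : SellerSet k}
    (hγ : γ ∈ active t) (hγ' : γ' ∈ active t) (hne : γ ≠ γ') :
    M.gap α i γd γ ^ 2 < 10 * (lam * hammingFrac γ γ') ^ 2 ∨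
      M.gap α i γd γ' ^ 2 < 10 * (lam * hammingFrac γ γ') ^ 2 := by
  induction t with
  | zero =>
    obtain ⟨γ₀, hγ₀⟩ := h.init
    rw [hγ₀, mem_singleton] at hγ hγ'
    exact absurd (hγ.trans hγ'.symm) hne
  | succ t ih =>
    have hnew : ∀ γ₁ γ₂, ¬ IsCovered lam T order t (active t) γ₁ → γ₂ ∈ active t →
        M.gap α i γd γ₂ ^ 2 < 10 * (lam * hammingFrac γ₁ γ₂) ^ 2 := by
      intro γ₁ γ₂ hγ₁ hγ₂
      have hlt := pow_lt_pow_left₀ (lt_hammingFrac_of_not_isCovered hγ₁ hγ₂)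
        (confRadius_nonneg _ _ _ _) two_ne_zero
      linarith [h.gap_sq_le hlam hT hcl hclean (Nat.le_of_succ_le ht) γ₂]
    by_cases hcov : ∀ γ, IsCovered lam T order t (active t) γ
    · rw [h.keep t ht hcov] at hγ hγ'
      exact ih (by lia) hγ hγ'
    · obtain ⟨γ₁, hγ₁, hinsert⟩ := h.activate t ht (not_forall.1 hcov)
      rw [hinsert, mem_insert] at hγ hγ'
      rcases hγ with rfl | hγ <;> rcases hγ' with rfl | hγ'
      · exact absurd rfl hne
      · exact .inr (hnew _ _ hγ₁ hγ')
      · exact .inl (hammingFrac_comm γ' γ ▸ hnew _ _ hγ₁ hγ)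
      · exact ih (by lia) hγ hγ'

lemma card_active_erase_le (h : M.IsZoomingPath α lam T i x active order) (hlam : 0 ≤ lam)
    (hT : lam ^ 2 ≤ 12 * Real.log T) (hcl : M.Closeness α lam i γd)
    (hclean : M.IsClean α T i x order) :
    (#((active T).erase γd) : ℝ) ≤ k * (160 * 2 ^ (3 * (k : ℝ) / 4)) := by
  have hcard := card_le_of_separated_on_spheres (notMem_erase γd (active T)) fun γ hγ γ' hγ'
      hne heq => ?_
  · simpa using hcard
  obtain ⟨hγd, hγ⟩ := mem_erase.1 hγ
  have hpos : 1 ≤ #(γ ∆ γd) := card_pos.2 (symmDiff_nonempty.2 hγd)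
  rcases h.gap_sq_lt_of_mem_active hlam hT hcl hclean le_rfl hγ (mem_of_mem_erase hγ') hne
    with hlt | hlt
  · exact hcl.four_mul_card_lt hlam hpos hlt
  · exact heq ▸ hcl.four_mul_card_lt hlam (heq ▸ hpos) hlt

lemma pullCount_mul_gap_le_sqrt (h : M.IsZoomingPath α lam T i x active order) (hlam : 0 ≤ lam)
    (hT : lam ^ 2 ≤ 12 * Real.log T) (hcl : M.Closeness α lam i γd)
    (hclean : M.IsClean α T i x order) (γ : SellerSet k) :
    pullCount order T γ * M.gap α i γd γ ≤ 11 * √(T * Real.log T) := by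
  have hcount : (pullCount order T γ : ℝ) ≤ T := by exact_mod_cast pullCount_le order T γ
  have hlog := Real.log_natCast_nonneg T
  refine le_of_sq_le_sq ?_ (by positivity)
  calc (pullCount order T γ * M.gap α i γd γ) ^ 2
      = pullCount order T γ * (pullCount order T γ * M.gap α i γd γ ^ 2) := by ring
    _ ≤ T * (108 * Real.log T) :=
        mul_le_mul hcount (h.pullCount_mul_gap_sq_le hlam hT hcl hclean le_rfl γ)
          (by positivity) (by positivity)
    _ ≤ 121 * (T * Real.log T) := by linarith [mul_nonneg (Nat.cast_nonneg (α := ℝ) T) hlog]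
    _ = (11 * √(T * Real.log T)) ^ 2 := by rw [mul_pow, Real.sq_sqrt (by positivity)]; norm_num

lemma pullCount_mul_gap_le_log (h : M.IsZoomingPath α lam T i x active order) (hlam : 0 < lam)
    (hT : lam ^ 2 ≤ 12 * Real.log T) (hcl : M.Closeness α lam i γd)
    (hclean : M.IsClean α T i x order) {γ : SellerSet k} (hγ : 2 ≤ #(γ ∆ γd)) :
    pullCount order T γ * M.gap α i γd γ ≤ 108 * Real.log T * k / lam := by
  have hk : (0 : ℝ) < k := by
    have hcard := (card_le_univ (γ ∆ γd)).trans_eq (Fintype.card_fin k)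
    exact_mod_cast (by lia : 0 < k)
  have hgap := hcl.gap_nonneg hlam.le γ
  rw [le_div_iff₀ hlam, ← div_le_iff₀ hk]
  calc pullCount order T γ * M.gap α i γd γ * lam / k
      = pullCount order T γ * M.gap α i γd γ * (lam / k) := mul_div_assoc _ _ _
    _ ≤ pullCount order T γ * M.gap α i γd γ * M.gap α i γd γ := by
        gcongr
        exact hcl.div_le_gap hlam.le hγ
    _ = pullCount order T γ * M.gap α i γd γ ^ 2 := by ring
    _ ≤ 108 * Real.log T := h.pullCount_mul_gap_sq_le hlam.le hT hcl hclean le_rfl γ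

lemma pullCount_mul_gap_le (h : M.IsZoomingPath α lam T i x active order) (hlam : 0 < lam)
    (hT : lam ^ 2 ≤ 12 * Real.log T) (hcl : M.Closeness α lam i γd)
    (hclean : M.IsClean α T i x order) (γ : SellerSet k) :
    pullCount order T γ * M.gap α i γd γ ≤
      (if #(γ ∆ γd) = 1 then 11 * √(T * Real.log T) else 0) +
        if γ ∈ (active T).erase γd then 108 * Real.log T * k / lam else 0 := by
  have hfar : 0 ≤ 108 * Real.log T * k / lam := by
    have := Real.log_natCast_nonneg T
    positivity
  by_cases hone : #(γ ∆ γd) = 1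
  · rw [if_pos hone]
    exact le_add_of_le_of_nonneg (h.pullCount_mul_gap_le_sqrt hlam.le hT hcl hclean γ)
      (by split_ifs <;> first | exact hfar | exact le_rfl)
  rw [if_neg hone, zero_add]
  rcases eq_or_ne γ γd with rfl | hne
  · simp [gap]
  have hpos : 0 < #(γ ∆ γd) := card_pos.2 (symmDiff_nonempty.2 hne)
  rcases eq_or_ne (pullCount order T γ) 0 with hzero | hpull
  · rw [hzero, Nat.cast_zero, zero_mul]
    split_ifs <;> first | exact hfar | exact le_rfl
  · rw [if_pos (mem_erase.2 ⟨hne, h.mem_active_of_pullCount_ne_zero le_rfl hpull⟩)]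
    exact h.pullCount_mul_gap_le_log hlam hT hcl hclean (by lia)

lemma sum_gap_order_le (h : M.IsZoomingPath α lam T i x active order) (hlam : 0 < lam)
    (hT : lam ^ 2 ≤ 12 * Real.log T) (hcl : M.Closeness α lam i γd)
    (hclean : M.IsClean α T i x order) :
    ∑ t ∈ range T, M.gap α i γd (order t) ≤ 11 * (k * √(T * Real.log T)) +
      17280 / lam * (k ^ 2 * Real.log T * 2 ^ (3 * (k : ℝ) / 4)) := by
  have := Real.log_natCast_nonneg T
  calc ∑ t ∈ range T, M.gap α i γd (order t)
      = ∑ γ, pullCount order T γ * M.gap α i γd γ := sum_comp_order_eq_sum_pullCount_mul ..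
    _ ≤ ∑ γ, ((if #(γ ∆ γd) = 1 then 11 * √(T * Real.log T) else 0) +
          if γ ∈ (active T).erase γd then 108 * Real.log T * k / lam else 0) :=
        sum_le_sum fun γ _ => h.pullCount_mul_gap_le hlam hT hcl hclean γ
    _ = k * (11 * √(T * Real.log T)) +
          #((active T).erase γd) * (108 * Real.log T * k / lam) := by
        rw [sum_add_distrib, sum_ite_mem, ← sum_filter, univ_inter, sum_const, sum_const,
          card_filter_card_symmDiff_eq, Fintype.card_fin, Nat.choose_one_right, nsmul_eq_mul,
          nsmul_eq_mul]
    _ ≤ k * (11 * √(T * Real.log T)) +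
          k * (160 * 2 ^ (3 * (k : ℝ) / 4)) * (108 * Real.log T * k / lam) := by
        gcongr
        exact h.card_active_erase_le hlam.le hT hcl hclean
    _ = _ := by ring

end IsZoomingPath

end DataMarket

namespace DataMarket

variable {n k : ℕ} {X : Type*} [MeasurableSpace X]

section EffUtility

variable (M : DataMarket n k X) {α : ℝ} (i : Fin n) (γ : SellerSet k)

lemma measurable_effUtility : Measurable (M.effUtility α i γ) :=
  ((M.perf_measurable i γ).sub_const _).sub
    ((Finset.measurable_fun_sum _ fun j _ => M.ext_measurable j i γ).const_mul α)

variable (hα : α ∈ Set.Icc (0 : ℝ) 1)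
include hα

lemma effUtility_mem_Icc (x : X) :
    M.effUtility α i γ x ∈ Set.Icc (-M.cost γ - 1) (1 - M.cost γ) := by
  have hperf := M.perf_mem i γ x
  have hext := M.ext_sum_mem i γ x
  have hnonneg := mul_nonneg hα.1 hext.1
  have hle := mul_le_one₀ hα.2 hext.1 hext.2
  unfold effUtility gain
  constructor <;> linarith [hperf.1, hperf.2]

lemma abs_effUtility_le (x : X) : |M.effUtility α i γ x| ≤ 2 := by
  have hmem := M.effUtility_mem_Icc i γ hα x
  have hcost := M.cost_mem γ
  exact abs_le.2 ⟨by linarith [hmem.1, hcost.2], by linarith [hmem.2, hcost.1]⟩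

lemma integrable_effUtility : Integrable (M.effUtility α i γ) M.law :=
  have := M.isProb
  .of_bound (M.measurable_effUtility i γ).aestronglyMeasurable 2
    (.of_forall fun x => M.abs_effUtility_le i γ hα x)

lemma abs_meanEffUtility_le : |M.meanEffUtility α i γ| ≤ 2 := by
  have := M.isProb
  simpa [meanEffUtility] using norm_integral_le_of_norm_le_const (μ := M.law)
    (f := M.effUtility α i γ) (.of_forall fun x => M.abs_effUtility_le i γ hα x)

lemma hasSubgaussianMGF_effUtility_sub_mean :
    HasSubgaussianMGF (fun x => M.effUtility α i γ x - M.meanEffUtility α i γ) 1 M.law := by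
  have := M.isProb
  have hoeffding := hasSubgaussianMGF_of_mem_Icc (μ := M.law)
    (M.measurable_effUtility i γ).aemeasurable
    (.of_forall fun x => M.effUtility_mem_Icc i γ hα x)
  have hlength : 1 - M.cost γ - (-M.cost γ - 1) = 2 := by ring
  convert! hoeffding using 1
  rw [hlength]
  ext
  simp

end EffUtility

variable {Ω : Type*}

/-- The event that round `r` carries one of the first `m` orders of `γ`. -/
def firstPulls (order : ℕ → Ω → SellerSet k) (γ : SellerSet k) (m r : ℕ) : Set Ω :=
  {ω | order r ω = γ ∧ pullCount (fun s => order s ω) r γ < m}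

/-- Sum of the deviations from the mean of the effective utilities that buyer `i` observed in her
first `m` orders of `γ` (in all of them, if there are fewer than `m` before round `T`). For each
fixed `m` it is a sum over a predictable set of rounds; the empirical means of the algorithm, whose
number of summands is random, are obtained by letting `m` vary. -/
noncomputable def pullDeviation (M : DataMarket n k X) (α : ℝ) (T : ℕ) (i : Fin n) (ξ : ℕ → Ω → X)
    (order : ℕ → Ω → SellerSet k) (γ : SellerSet k) (m : ℕ) (ω : Ω) : ℝ :=
  ∑ r ∈ Finset.range T, (firstPulls order γ m r).indicator
    (fun ω => M.effUtility α i γ (ξ r ω) - M.meanEffUtility α i γ) ω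

variable {M : DataMarket n k X} {α lam : ℝ} {T : ℕ} {i : Fin n} {γd γ : SellerSet k}
  {ξ : ℕ → Ω → X} {active : ℕ → Ω → Finset (SellerSet k)} {order : ℕ → Ω → SellerSet k}

lemma sum_indicator_firstPulls (m : ℕ) (f : ℕ → Ω → ℝ) (ω : Ω) :
    ∑ r ∈ Finset.range T, (firstPulls order γ m r).indicator (f r) ω =
      ∑ r ∈ Finset.range T with
        order r ω = γ ∧ pullCount (fun s => order s ω) r γ < m, f r ω := by
  simp [Finset.sum_filter, firstPulls, Set.indicator_apply]

lemma sum_indicator_one_firstPulls_le (m : ℕ) (ω : Ω) :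
    ∑ r ∈ Finset.range T, (firstPulls order γ m r).indicator 1 ω ≤ (m : ℝ) := by
  rw [sum_indicator_firstPulls m fun _ => 1]
  simp [card_filter_pullCount_lt fun s => order s ω]

lemma pullDeviation_pullCount {t : ℕ} (ht : t ≤ T) (ω : Ω) :
    M.pullDeviation α T i ξ order γ (pullCount (fun s => order s ω) t γ) ω =
      pullCount (fun s => order s ω) t γ *
        (M.empMean α i (fun s => ξ s ω) (fun s => order s ω) t γ - M.meanEffUtility α i γ) := by
  rw [pullDeviation, sum_indicator_firstPulls,
    filter_pullCount_lt_pullCount (fun s => order s ω) γ ht, Finset.sum_sub_distrib,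
    Finset.sum_const, nsmul_eq_mul, mul_sub, empMean, mul_div_cancel_of_imp', pullCount]
  intro hzero
  have hempty : {s ∈ Finset.range t | order s ω = γ} = ∅ :=
    Finset.card_eq_zero.1 (by exact_mod_cast hzero)
  rw [hempty, Finset.sum_empty]

lemma isClean_of_abs_pullDeviation_lt (hα : α ∈ Set.Icc (0 : ℝ) 1) (hT : 2 ≤ T) {ω : Ω}
    (hω : ∀ γ, ∀ m ∈ Finset.Icc 1 T,
      |M.pullDeviation α T i ξ order γ m ω| < m * √(12 * Real.log T / (m + 1))) :
    M.IsClean α T i (fun t => ξ t ω) (fun t => order t ω) := by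
  intro t ht γ
  rcases Nat.eq_zero_or_pos (pullCount (fun s => order s ω) t γ) with hzero | hpos
  · rw [empMean, hzero, Nat.cast_zero, div_zero, zero_sub, abs_neg]
    exact (M.abs_meanEffUtility_le i γ hα).trans (two_le_confRadius hT hzero)
  · have hlt := hω γ _ (Finset.mem_Icc.2 ⟨hpos, (pullCount_le _ _ _).trans ht.le⟩)
    rw [pullDeviation_pullCount ht.le, abs_mul, Nat.abs_cast] at hlt
    exact (lt_of_mul_lt_mul_left hlt (Nat.cast_nonneg _)).le

variable {mΩ : MeasurableSpace Ω} {P : Measure Ω} {ℱ : Filtration ℕ mΩ}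

namespace RunsZooming

lemma measurable_pullCount (h : M.RunsZooming α lam T i ℱ ξ active order) (γ : SellerSet k)
    {t : ℕ} (ht : t ≤ T) : Measurable[ℱ t] fun ω => pullCount (fun s => order s ω) t γ := by
  induction t with
  | zero =>
    simp only [pullCount_zero]
    exact measurable_const
  | succ t ih =>
    simp only [pullCount_succ]
    exact ((ih (by lia)).mono (ℱ.mono t.le_succ) le_rfl).add
      (.ite (ℱ.mono t.le_succ _ (h.nonanticipating t ht γ)) measurable_const measurable_const)

lemma measurableSet_firstPulls (h : M.RunsZooming α lam T i ℱ ξ active order) (γ : SellerSet k)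
    (m : ℕ) {t : ℕ} (ht : t < T) : MeasurableSet[ℱ t] (firstPulls order γ m t) :=
  MeasurableSet.inter (h.nonanticipating t ht γ)
    (h.measurable_pullCount γ ht.le (measurableSet_Iio (a := m)))

lemma measurable_order (h : M.RunsZooming α lam T i ℱ ξ active order) {t : ℕ} (ht : t < T) :
    Measurable[ℱ t] (order t) :=
  @measurable_to_countable' _ _ _ _ (ℱ t) _ fun γ => h.nonanticipating t ht γ

lemma integrable_comp_order [IsFiniteMeasure P] (h : M.RunsZooming α lam T i ℱ ξ active order)
    {t : ℕ} (ht : t < T) (f : SellerSet k → ℝ) : Integrable (fun ω => f (order t ω)) P :=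
  .of_bound ((measurable_of_countable f).comp
    ((h.measurable_order ht).mono (ℱ.le t) le_rfl)).aestronglyMeasurable (∑ γ, |f γ|)
    (.of_forall fun ω => Finset.single_le_sum (f := fun γ => |f γ|) (fun _ _ => abs_nonneg _)
      (Finset.mem_univ (order t ω)))

lemma integrable_sum_gap [IsFiniteMeasure P] (h : M.RunsZooming α lam T i ℱ ξ active order)
    (γd : SellerSet k) :
    Integrable (fun ω => ∑ t ∈ Finset.range T, M.gap α i γd (order t ω)) P :=
  integrable_finsetSum _ fun _ ht => h.integrable_comp_order (Finset.mem_range.1 ht) _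

end RunsZooming

lemma hasSubgaussianMGF_pullDeviation [IsProbabilityMeasure P] (hM : M.IsRepeatedMarket P ℱ ξ)
    (h : M.RunsZooming α lam T i ℱ ξ active order) (hα : α ∈ Set.Icc (0 : ℝ) 1)
    (γ : SellerSet k) (m : ℕ) :
    HasSubgaussianMGF (M.pullDeviation α T i ξ order γ m) m P := by
  have hdev : Measurable fun x => M.effUtility α i γ x - M.meanEffUtility α i γ :=
    (M.measurable_effUtility i γ).sub_const _
  have hsum := hasSubgaussianMGF_sum_indicator (P := P) (c := 1) (m := m)
    (fun t ht => h.measurableSet_firstPulls γ m ht) (fun t => hdev.comp (hM.adapted t))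
    (fun t => indep_of_indep_of_le_left (hM.indep t)
      (hdev.comp (comap_measurable (ξ t))).comap_le)
    (fun t => .of_map ((hM.adapted t).mono (ℱ.le _) le_rfl).aemeasurable
      (hM.map_eq t ▸ M.hasSubgaussianMGF_effUtility_sub_mean i γ hα))
    (fun ω => sum_indicator_one_firstPulls_le m ω)
  rwa [mul_one] at hsum

lemma measureReal_le_abs_pullDeviation_le [IsProbabilityMeasure P]
    (hM : M.IsRepeatedMarket P ℱ ξ) (h : M.RunsZooming α lam T i ℱ ξ active order)
    (hα : α ∈ Set.Icc (0 : ℝ) 1) (hT : 0 < T) (γ : SellerSet k) {m : ℕ} (hm : 1 ≤ m) :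
    P.real {ω | m * √(12 * Real.log T / (m + 1)) ≤ |M.pullDeviation α T i ξ order γ m ω|} ≤
      2 * ((T : ℝ) ^ 3)⁻¹ := by
  have hlog := Real.log_natCast_nonneg T
  have hm' : (1 : ℝ) ≤ m := by exact_mod_cast hm
  have hpow : ((T : ℝ) ^ 3)⁻¹ = Real.exp (-(3 * Real.log T)) := by
    rw [Real.exp_neg, mul_comm, Real.exp_mul, Real.exp_log (by exact_mod_cast hT)]
    norm_cast
  refine (measureReal_le_abs_le_of_hasSubgaussianMGF
    (hasSubgaussianMGF_pullDeviation hM h hα γ m) (by positivity)).trans ?_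
  rw [hpow, NNReal.coe_natCast]
  gcongr 2 * Real.exp ?_
  rw [neg_div, neg_le_neg_iff, le_div_iff₀ (by positivity), mul_pow, Real.sq_sqrt (by positivity),
    ← mul_div_assoc, le_div_iff₀ (by positivity)]
  linarith [mul_nonneg (mul_nonneg (Nat.cast_nonneg (α := ℝ) m) (sub_nonneg.2 hm')) hlog]

lemma measureReal_not_isClean_mul_sq_le [IsProbabilityMeasure P] (hM : M.IsRepeatedMarket P ℱ ξ)
    (h : M.RunsZooming α lam T i ℱ ξ active order) (hα : α ∈ Set.Icc (0 : ℝ) 1) (hT : 2 ≤ T) :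
    P.real {ω | ¬ M.IsClean α T i (fun t => ξ t ω) (fun t => order t ω)} * T ^ 2 ≤ 2 * 2 ^ k := by
  set bad : SellerSet k × ℕ → Set Ω := fun p =>
    {ω | p.2 * √(12 * Real.log T / (p.2 + 1)) ≤ |M.pullDeviation α T i ξ order p.1 p.2 ω|}
  have hsubset : {ω | ¬ M.IsClean α T i (fun t => ξ t ω) (fun t => order t ω)} ⊆
      ⋃ p ∈ Finset.univ ×ˢ Finset.Icc 1 T, bad p := by
    intro ω hω
    by_contra hgood
    refine hω (isClean_of_abs_pullDeviation_lt hα hT fun γ m hm => lt_of_not_ge fun hle => ?_)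
    exact hgood (Set.mem_biUnion (Finset.mk_mem_product (Finset.mem_univ γ) hm) hle)
  have hprob : P.real {ω | ¬ M.IsClean α T i (fun t => ξ t ω) (fun t => order t ω)} ≤
      2 ^ k * T * (2 * ((T : ℝ) ^ 3)⁻¹) :=
    calc _ ≤ ∑ p ∈ Finset.univ ×ˢ Finset.Icc 1 T, P.real (bad p) :=
          (measureReal_mono hsubset (measure_ne_top P _)).trans (measureReal_biUnion_finset_le _ _)
      _ ≤ _ := (Finset.sum_le_card_nsmul _ _ _ fun p hp =>
          measureReal_le_abs_pullDeviation_le hM h hα (by lia) p.1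
            (Finset.mem_Icc.1 (Finset.mem_product.1 hp).2).1).trans_eq (by simp)
  calc _ ≤ 2 ^ k * T * (2 * ((T : ℝ) ^ 3)⁻¹) * T ^ 2 := by gcongr
    _ = 2 * 2 ^ k := by field_simp

lemma mul_measureReal_not_isClean_le [IsProbabilityMeasure P] (hM : M.IsRepeatedMarket P ℱ ξ)
    (h : M.RunsZooming α lam T i ℱ ξ active order) (hα : α ∈ Set.Icc (0 : ℝ) 1) (hT : 2 ≤ T) :
    T * P.real {ω | ¬ M.IsClean α T i (fun t => ξ t ω) (fun t => order t ω)} ≤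
      2 * 2 ^ (3 * (k : ℝ) / 4) := by
  set p := P.real {ω | ¬ M.IsClean α T i (fun t => ξ t ω) (fun t => order t ω)}
  have hp : p ≤ 1 := measureReal_le_one
  have : 0 ≤ p := measureReal_nonneg
  have hpow : (2 : ℝ) ^ k ≤ (2 ^ (3 * (k : ℝ) / 4)) ^ 2 := by
    rw [← Real.rpow_mul_natCast zero_le_two, ← Real.rpow_natCast]
    refine Real.rpow_le_rpow_of_exponent_le one_le_two ?_
    push_cast
    linarith [Nat.cast_nonneg (α := ℝ) k]
  refine le_of_sq_le_sq ?_ (by positivity)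
  calc (T * p) ^ 2 = p * (p * T ^ 2) := by ring
    _ ≤ 1 * (2 * 2 ^ k) :=
        mul_le_mul hp (measureReal_not_isClean_mul_sq_le hM h hα hT) (by positivity) zero_le_one
    _ ≤ (2 * 2 ^ (3 * (k : ℝ) / 4)) ^ 2 := by rw [mul_pow]; linarith [pow_pos two_pos k (M₀ := ℝ)]

end DataMarket

namespace DataMarket

variable {n k : ℕ} {X : Type*} [MeasurableSpace X] {M : DataMarket n k X} {α lam : ℝ} {T : ℕ}
  {i : Fin n} {γd : SellerSet k} {Ω : Type*} {mΩ : MeasurableSpace Ω} {P : Measure Ω}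
  {ℱ : Filtration ℕ mΩ} {ξ : ℕ → Ω → X} {active : ℕ → Ω → Finset (SellerSet k)}
  {order : ℕ → Ω → SellerSet k}

lemma integrable_and_integral_effUtility_sub_eq [IsFiniteMeasure P] (hM : M.IsRepeatedMarket P ℱ ξ)
    (h : M.RunsZooming α lam T i ℱ ξ active order) (hα : α ∈ Set.Icc (0 : ℝ) 1)
    (γd : SellerSet k) {t : ℕ} (ht : t < T) :
    Integrable
        (fun ω => M.effUtility α i γd (ξ t ω) - M.effUtility α i (order t ω) (ξ t ω)) P ∧
      ∫ ω, M.effUtility α i γd (ξ t ω) - M.effUtility α i (order t ω) (ξ t ω) ∂P =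
        ∫ ω, M.gap α i γd (order t ω) ∂P := by
  set f : SellerSet k × X → ℝ := fun p => M.effUtility α i γd p.2 - M.effUtility α i p.1 p.2
  have hf : Measurable f := measurable_from_prod_countable_right fun γ =>
    (M.measurable_effUtility i γd).sub (M.measurable_effUtility i γ)
  have hfbdd : ∀ p, ‖f p‖ ≤ 4 := fun p => (abs_sub _ _).trans
    (by linarith [M.abs_effUtility_le i γd hα p.2, M.abs_effUtility_le i p.1 hα p.2])
  have hord : Measurable (order t) := (h.measurable_order ht).mono (ℱ.le t) le_rfl
  have hξ : Measurable (ξ t) := (hM.adapted t).mono (ℱ.le _) le_rfl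
  have hindep : IndepFun (order t) (ξ t) P := by
    rw [IndepFun_iff_Indep]
    exact indep_of_indep_of_le_left (hM.indep t).symm (h.measurable_order ht).comap_le
  refine ⟨.of_bound (hf.comp (hord.prodMk hξ)).aestronglyMeasurable 4
    (.of_forall fun ω => hfbdd (order t ω, ξ t ω)), ?_⟩
  calc _ = ∫ ω, ∫ x, f (order t ω, x) ∂(P.map (ξ t)) ∂P :=
        integral_comp_of_indepFun hord.aemeasurable hξ.aemeasurable hindep
          (.of_bound hf.aestronglyMeasurable 4 (.of_forall hfbdd))
    _ = ∫ ω, M.gap α i γd (order t ω) ∂P := by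
        refine integral_congr_ae (.of_forall fun ω => ?_)
        rw [hM.map_eq]
        exact integral_sub (M.integrable_effUtility i γd hα) (M.integrable_effUtility i _ hα)

lemma effRegret_eq_integral_sum_gap [IsFiniteMeasure P] (hM : M.IsRepeatedMarket P ℱ ξ)
    (h : M.RunsZooming α lam T i ℱ ξ active order) (hα : α ∈ Set.Icc (0 : ℝ) 1)
    (γd : SellerSet k) :
    M.effRegret α i P ξ order γd T =
      ∫ ω, ∑ t ∈ Finset.range T, M.gap α i γd (order t ω) ∂P := by
  rw [effRegret, integral_finsetSum _ fun t ht =>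
      (integrable_and_integral_effUtility_sub_eq hM h hα γd (Finset.mem_range.1 ht)).1,
    integral_finsetSum _ fun t ht => h.integrable_comp_order (Finset.mem_range.1 ht) _]
  exact Finset.sum_congr rfl fun t ht =>
    (integrable_and_integral_effUtility_sub_eq hM h hα γd (Finset.mem_range.1 ht)).2

lemma Closeness.sum_gap_le (hcl : M.Closeness α lam i γd) (hlam : 0 ≤ lam)
    (order : ℕ → SellerSet k) : ∑ t ∈ Finset.range T, M.gap α i γd (order t) ≤ lam * T :=
  (Finset.sum_le_card_nsmul _ _ lam fun t _ => hcl.gap_le_lam hlam _).trans_eq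
    (by rw [Finset.card_range, nsmul_eq_mul, mul_comm])

lemma effRegret_le_lam_mul [IsProbabilityMeasure P] (hM : M.IsRepeatedMarket P ℱ ξ)
    (h : M.RunsZooming α lam T i ℱ ξ active order) (hα : α ∈ Set.Icc (0 : ℝ) 1) (hlam : 0 ≤ lam)
    (hcl : M.Closeness α lam i γd) : M.effRegret α i P ξ order γd T ≤ lam * T := by
  rw [effRegret_eq_integral_sum_gap hM h hα]
  exact (integral_mono (h.integrable_sum_gap γd) (integrable_const _) fun ω =>
    hcl.sum_gap_le hlam fun t => order t ω).trans_eq (by simp)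

lemma effRegret_le [IsProbabilityMeasure P] (hM : M.IsRepeatedMarket P ℱ ξ)
    (h : M.RunsZooming α lam T i ℱ ξ active order) (hα : α ∈ Set.Icc (0 : ℝ) 1) (hlam : 0 < lam)
    (hcl : M.Closeness α lam i γd) (hT : 2 ≤ T) (hlog : lam ^ 2 ≤ 12 * Real.log T) :
    M.effRegret α i P ξ order γd T ≤ 11 * (k * √(T * Real.log T)) +
      17280 / lam * (k ^ 2 * Real.log T * 2 ^ (3 * (k : ℝ) / 4)) +
        2 * lam * 2 ^ (3 * (k : ℝ) / 4) := by
  set a := 11 * (k * √(T * Real.log T)) +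
    17280 / lam * (k ^ 2 * Real.log T * 2 ^ (3 * (k : ℝ) / 4))
  set bad := {ω | ¬ M.IsClean α T i (fun t => ξ t ω) (fun t => order t ω)}
  have ha : 0 ≤ a := by
    have := Real.log_natCast_nonneg T
    positivity
  calc M.effRegret α i P ξ order γd T
      = ∫ ω, ∑ t ∈ Finset.range T, M.gap α i γd (order t ω) ∂P :=
        effRegret_eq_integral_sum_gap hM h hα γd
    _ ≤ a + lam * T * P.real bad :=
        integral_le_add_mul_measureReal (h.integrable_sum_gap γd)
          (fun ω hω => (h.path ω).sum_gap_order_le hlam hlog hcl (not_not.1 hω))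
          (fun ω => (hcl.sum_gap_le hlam.le _).trans (le_add_of_nonneg_left ha))
    _ = a + lam * (T * P.real bad) := by ring
    _ ≤ a + lam * (2 * 2 ^ (3 * (k : ℝ) / 4)) := by
        gcongr a + lam * ?_
        exact mul_measureReal_not_isClean_le hM h hα hT
    _ = a + 2 * lam * 2 ^ (3 * (k : ℝ) / 4) := by ring

end DataMarket

lemma two_rpow_le_two_mul {k T : ℕ} (hk : 1 ≤ k) (hT : 2 ≤ T) :
    (2 : ℝ) ^ (3 * (k : ℝ) / 4) ≤ 2 * (k ^ 2 * Real.log T * 2 ^ (3 * (k : ℝ) / 4)) := by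
  have hk' : 1 ≤ (k : ℝ) ^ 2 := one_le_pow₀ (by exact_mod_cast hk)
  have hlog : 1 ≤ 2 * Real.log T := by linarith [half_le_log_natCast hT]
  calc (2 : ℝ) ^ (3 * (k : ℝ) / 4) ≤ k ^ 2 * (2 * Real.log T) * 2 ^ (3 * (k : ℝ) / 4) :=
        le_mul_of_one_le_left (by positivity) (one_le_mul_of_one_le_of_one_le hk' hlog)
    _ = 2 * (k ^ 2 * Real.log T * 2 ^ (3 * (k : ℝ) / 4)) := by ring

lemma rate_le_two_mul_rate {k T : ℕ} {C : ℝ} (hC : 0 ≤ C) (hT : 2 ≤ T) :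
    C * (k * √(T * Real.log T)) + C * (k ^ 2 * Real.log T * 2 ^ (3 * (k : ℝ) / 4)) ≤
      2 * C * (k ^ 2 * √(T * Real.log T)) +
        2 * C * (k ^ 3 * Real.log T ^ 2 * 2 ^ (3 * (k : ℝ) / 4)) := by
  have hlog := half_le_log_natCast hT
  have hk : (k : ℝ) ≤ k ^ 2 := by exact_mod_cast Nat.le_self_pow two_ne_zero k
  calc C * (k * √(T * Real.log T)) + C * (k ^ 2 * Real.log T * 2 ^ (3 * (k : ℝ) / 4))
      = C * (k * √(T * Real.log T)) +
          C * (k * (k * Real.log T) * 1 * 2 ^ (3 * (k : ℝ) / 4)) := by ring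
    _ ≤ 2 * C * (k ^ 2 * √(T * Real.log T)) + C * (k * (k ^ 2 * Real.log T) *
          (2 * Real.log T) * 2 ^ (3 * (k : ℝ) / 4)) := by gcongr <;> linarith
    _ = _ := by ring

theorem mainTheorem1_general (lam : ℝ) (hlam : 0 < lam) :
    ∃ C : ℝ, 0 < C ∧
      ∀ (n k : ℕ) (X : Type*) [MeasurableSpace X] (M : DataMarket n k X)
        (α : ℝ) (_ : α ∈ Set.Icc (0 : ℝ) 1) (T : ℕ) (_ : 2 ≤ T)
        (Ω : Type*) [mΩ : MeasurableSpace Ω] (P : Measure Ω) [IsProbabilityMeasure P]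
        (ℱ : Filtration ℕ mΩ) (ξ : ℕ → Ω → X) (_ : M.IsRepeatedMarket P ℱ ξ)
        (i : Fin n) (γd : SellerSet k) (_ : M.Closeness α lam i γd)
        (active : ℕ → Ω → Finset (SellerSet k)) (order : ℕ → Ω → SellerSet k)
        (_ : M.RunsZooming α lam T i ℱ ξ active order),
        M.effRegret α i P ξ order γd T ≤
          C * (k * √(T * Real.log T)) +
            C * (k ^ 2 * Real.log T * (2 : ℝ) ^ (3 * (k : ℝ) / 4)) := by
  set C := 11 + 17280 / lam + 4 * lam + 2 * lam * Real.exp (lam ^ 2 / 12)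
  have hfar : 0 < 17280 / lam := by positivity
  have hexp : 0 < 2 * lam * Real.exp (lam ^ 2 / 12) := by positivity
  refine ⟨C, by positivity, ?_⟩
  intro n k X _ M α hα T hT Ω _ P _ ℱ ξ hM i γd hcl active order hrun
  rcases Nat.eq_zero_or_pos k with rfl | hk
  · have horder : ∀ t ω, order t ω = γd := fun t ω => Subsingleton.elim _ _
    simp [DataMarket.effRegret, horder]
  have hB := two_rpow_le_two_mul hk hT
  have hQ : 1 ≤ (2 : ℝ) ^ (3 * (k : ℝ) / 4) := Real.one_le_rpow one_le_two (by positivity)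
  set A := k * √(T * Real.log T)
  set Q := (2 : ℝ) ^ (3 * (k : ℝ) / 4)
  set B := k ^ 2 * Real.log T * Q
  have : 0 ≤ A := by positivity
  rcases lt_or_ge (12 * Real.log T) (lam ^ 2) with hshort | hlong
  · have hTexp : (T : ℝ) ≤ Real.exp (lam ^ 2 / 12) :=
      (Real.log_le_iff_le_exp (by positivity)).1 (by linarith)
    calc M.effRegret α i P ξ order γd T ≤ lam * T :=
          DataMarket.effRegret_le_lam_mul hM hrun hα hlam.le hcl
      _ ≤ lam * Real.exp (lam ^ 2 / 12) * (2 * B) := by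
          rw [mul_assoc]
          gcongr
          exact hTexp.trans (le_mul_of_one_le_right (Real.exp_pos _).le (hQ.trans hB))
      _ = 0 * A + 2 * lam * Real.exp (lam ^ 2 / 12) * B := by ring
      _ ≤ C * A + C * B := by gcongr <;> linarith
  · calc M.effRegret α i P ξ order γd T ≤ 11 * A + 17280 / lam * B + 2 * lam * Q :=
          DataMarket.effRegret_le hM hrun hα hlam hcl hT hlong
      _ ≤ 11 * A + 17280 / lam * B + 2 * lam * (2 * B) := by gcongr
      _ = 11 * A + (17280 / lam + 4 * lam) * B := by ring
      _ ≤ C * A + C * B := by gcongr <;> linarith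

theorem mainTheorem1 (lam : ℝ) (hlam : 0 < lam) :
    ∃ C : ℝ, 0 < C ∧
      ∀ (n k : ℕ) (X : Type*) [MeasurableSpace X] (M : DataMarket n k X)
        (α : ℝ) (_ : α ∈ Set.Icc (0 : ℝ) 1) (T : ℕ) (_ : 2 ≤ T)
        (Ω : Type*) [mΩ : MeasurableSpace Ω] (P : Measure Ω) [IsProbabilityMeasure P]
        (ℱ : Filtration ℕ mΩ) (ξ : ℕ → Ω → X) (_ : M.IsRepeatedMarket P ℱ ξ)
        (i : Fin n) (γd : SellerSet k) (_ : M.IsDominantStrategy α i γd)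
        (_ : M.Closeness α lam i γd)
        (active : ℕ → Ω → Finset (SellerSet k)) (order : ℕ → Ω → SellerSet k)
        (_ : M.RunsZooming α lam T i ℱ ξ active order),
        M.effRegret α i P ξ order γd T ≤
          C * ((k : ℝ) ^ 2 * Real.sqrt (T * Real.log T)) +
            C * ((k : ℝ) ^ 3 * Real.log T ^ 2 * (2 : ℝ) ^ (3 * (k : ℝ) / 4)) := by
  obtain ⟨C, hC, hregret⟩ := mainTheorem1_general lam hlam
  refine ⟨2 * C, by positivity, ?_⟩
  intro n k X _ M α hα T hT Ω _ P _ ℱ ξ hM i γd _ hcl active order hrun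
  exact (hregret n k X M α hα T hT Ω P ℱ ξ hM i γd hcl active order hrun).trans
    (rate_le_two_mul_rate hC.le hT)
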